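/- For each $n\ge 1$ let $X_{n,1},\dots,X_{n,n}$ be random variables on a probability space $(\Omega_n,\mathcal F_n,P_n)$, not necessarily identically distributed, with values in the nonnegative integers and $X_{n,j}\le C_0$ almost surely for all $1\le j\le n$, where $C_0\ge 1$ is a constant not depending on $n$. Assume that each row is $1$-dependent: for all $1\le u<t\le n$ with $t-u>1$, the $\sigma$-algebras generated by $X_{n,1},\dots,X_{n,u}$ and by $X_{n,t},\dots,X_{n,n}$ are independent. Let $S_n=X_{n,1}+\dots+X_{n,n}$ and let $\nu_m(j)=\nu_{m,n}(j)=\mathbb E\,X_{n,j}(X_{n,j}-1)\cdots(X_{n,j}-m+1)$ be the $m$-th factorial moment of $X_{n,j}$. Let an integer $s\ge1$ and real numbers $\lambda_1,\dots,\lambda_s\ge0$ and $h\ge0$ be fixed, and let $\mathrm{CP}(s,\lambda)$ be the compound Poisson distribution, i.e. the distribution of $N_1+2N_2+\dots+sN_s$, where $N_1,\dots,N_s$ are independent and $N_i$ is Poisson with parameter $\lambda_i$. Suppose that, as $n\to\infty$, 1. $\max_{1\le j\le n}\nu_1(j)\to0$; 2. $\frac1{m!}\sum_{j=1}^n\nu_m(j)\to\sum_{l=m}^s\binom{l}{m}\lambda_l$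 for every $m=1,\dots,s$; 3. $\sum_{j=1}^n\nu_{s+1}(j)\to0$; 4. $\sum_{j=2}^n|\mathrm{Cov}(X_{n,j-1},X_{n,j})|\to0$. Then the series $\sum_{k=0}^\infty e^{hk}\,|P_n(S_n=k)-\mathrm{CP}(s,\lambda)\{k\}|$ converges for every $n$, and $$\sum_{k=0}^\infty e^{hk}\,\bigl|P_n(S_n=k)-\mathrm{CP}(s,\lambda)\{k\}\bigr|\to0\qquad(n\to\infty).$$ -/

import Mathlib

open MeasureTheory ProbabilityTheory Filter Topology
open scoped NNReal

/-- The random variables `X 1, …, X n` are `m`-dependent: whenever `1 ≤ s`, `t ≤ n` and `t - s > m`,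
the sigma-algebras generated by `X 1, …, X s` and by `X t, …, X n` are independent. -/
def IsMDependent {Ω : Type*} [MeasurableSpace Ω] (m n : ℕ) (X : ℕ → Ω → ℕ) (μ : Measure Ω) : Prop :=
  ∀ s t : ℕ, 1 ≤ s → s + m < t → t ≤ n →
    Indep (⨆ i ∈ Set.Icc 1 s, MeasurableSpace.comap (X i) inferInstance)
      (⨆ i ∈ Set.Icc t n, MeasurableSpace.comap (X i) inferInstance) μ

/-- The `j`-th factorial moment `E[Y (Y - 1) ⋯ (Y - j + 1)]` of an `ℕ`-valued random variable. -/
noncomputable def factorialMoment {Ω : Type*} [MeasurableSpace Ω] (j : ℕ) (Y : Ω → ℕ)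
    (μ : Measure Ω) : ℝ :=
  ∫ ω, ((Y ω).descFactorial j : ℝ) ∂μ

/-- The compound Poisson distribution `CP(s, lam)`: the law of `N₁ + 2 N₂ + ⋯ + s Nₛ`, where
`N₁, …, Nₛ` are independent and `Nᵢ` is Poisson with parameter `lam i`. The index `i : Fin s`
stands for `i + 1 ∈ {1, …, s}`. -/
noncomputable def compoundPoisson (s : ℕ) (lam : ℕ → ℝ≥0) : Measure ℕ :=
  (Measure.pi fun i : Fin s => poissonMeasure (lam ((i : ℕ) + 1))).map
    fun N : Fin s → ℕ => ∑ i : Fin s, ((i : ℕ) + 1) * N i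

/-!
The weighted distance converges to zero because the point masses converge and the sums have
uniformly bounded exponential moments of an order larger than `h`.

*Point masses.* For `‖z‖ = 1` write `z ^ X (k + 2) = 1 + (z ^ X (k + 2) - 1)` and, in the second
contribution, `z ^ X (k + 1) = 1 + (z ^ X (k + 1) - 1)`. By `1`-dependence `X (k + 2)` is
independent of the first `k` variables, so that appending it multiplies the generating function by
`E z ^ X (k + 2)` up to an error of order `E X (k + 1) X (k + 2) + E X (k + 1) * E X (k + 2)`
(`IsMDependent.norm_integral_pow_sum_sub_mul_le`). Replacing the factor `a = E z ^ X (k + 2)` by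
`exp (a - 1)` costs a multiple of `(E X (k + 2)) ^ 2`. All quantities have modulus at most `1`, so
the errors add up, to at most a multiple of `∑ |Cov| + max ν₁ * ∑ ν₁`
(`IsMDependent.norm_integral_pow_sum_sub_exp_le`). It remains to find the limit of
`∑ (E z ^ X j - 1)`. Expanding at `z = 1` expresses it by the first `s` factorial moments and a remainder
controlled by the factorial moment of order `s + 1`
(`norm_sum_integral_pow_sub_sum_factorialMoment_le`), and the limit is `∑ lam l * (z ^ l - 1)`,
the exponent of the generating function of the compound Poisson distribution
(`integral_pow_compoundPoisson`). Fourier inversion turns this into convergence of the point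
masses (`tendsto_real_singleton_of_tendsto_integral_pow`).

*Exponential moments.* The sum splits into two sums over indices of equal parity, each with
independent summands, and `w ^ (a + b) ≤ (w ^ (2 * a) + w ^ (2 * b)) / 2`, which bounds `E w ^ S`
by an exponential of `∑ ν₁` (`IsMDependent.integral_pow_sum_le`). With `w = exp (h + 1)` the
`k`-th term of the series is at most a constant times `exp (-k)`, and dominated convergence
applies.
-/

/-! ### Probability measures on the natural numbers -/

lemma Finset.sum_range_succ_eq_add_sum_Icc {E : Type*} [AddCommMonoid E] (f : ℕ → E) (s : ℕ) :
    ∑ m ∈ Finset.range (s + 1), f m = f 0 + ∑ m ∈ Finset.Icc 1 s, f m := by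
  induction s with
  | zero => simp
  | succ s ih => rw [Finset.sum_range_succ, ih, Finset.sum_Icc_succ_top (by omega), add_assoc]

/-- Fourier inversion for a probability measure on `ℕ`. -/
lemma two_pi_mul_real_singleton_eq_integral (ρ : Measure ℕ) [IsProbabilityMeasure ρ] (k : ℕ) :
    (2 * Real.pi : ℂ) * (ρ.real {k} : ℂ) =
      ∫ t in (0 : ℝ)..2 * Real.pi, Complex.exp (-(k * t * Complex.I)) *
        ∫ x, Complex.exp (t * Complex.I) ^ x ∂ρ := by
  -- The integral over `t` of the kernel vanishes unless `x = k`.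
  have hker : ∀ x : ℕ, (∫ t in (0 : ℝ)..2 * Real.pi, Complex.exp (-(k * t * Complex.I)) *
      Complex.exp (t * Complex.I) ^ x) = Set.indicator {k} (fun _ => (2 * Real.pi : ℂ)) x := by
    intro x
    have h1 : ∀ t : ℝ, Complex.exp (-(k * t * Complex.I)) * Complex.exp (t * Complex.I) ^ x
        = Complex.exp ((((x : ℂ) - k) * Complex.I) * t) := by
      intro t
      rw [← Complex.exp_nat_mul, ← Complex.exp_add]
      ring_nf
    simp_rw [h1]
    by_cases hx : x = k
    · subst hx
      simp
    · have hne : ((x : ℂ) - k) * Complex.I ≠ 0 :=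
        mul_ne_zero (sub_ne_zero.2 (by exact_mod_cast hx)) Complex.I_ne_zero
      rw [integral_exp_mul_complex hne]
      have h2 : Complex.exp (((x : ℂ) - k) * Complex.I * ((2 * Real.pi : ℝ) : ℂ)) = 1 := by
        rw [Complex.exp_eq_one_iff]
        exact ⟨(x : ℤ) - k, by push_cast; ring⟩
      rw [h2]
      simp [hx]
  simp_rw [← integral_const_mul]
  rw [intervalIntegral_integral_swap]
  · simp_rw [hker]
    rw [integral_indicator (measurableSet_singleton k), setIntegral_const]
    simp [mul_comm]
  · have : IsFiniteMeasure (volume.restrict (Set.uIoc 0 (2 * Real.pi))) :=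
      ⟨by simp [Set.uIoc]⟩
    refine Integrable.of_bound (C := 1) ?_ ?_
    · refine Measurable.aestronglyMeasurable ?_
      refine measurable_from_prod_countable_left fun x => ?_
      simp only [Function.uncurry_apply_pair]
      fun_prop
    · refine Filter.Eventually.of_forall fun p => ?_
      have h1 : ‖Complex.exp (-(k * p.1 * Complex.I))‖ = 1 := by
        have := Complex.norm_exp_ofReal_mul_I (-(k * p.1))
        rw [← this]
        push_cast
        ring_nf
      simp [Function.uncurry, h1, Complex.norm_exp_ofReal_mul_I]

/-- Convergence of the generating functions on the unit circle implies convergence of the point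
masses, by Fourier inversion and dominated convergence. -/
lemma tendsto_real_singleton_of_tendsto_integral_pow {ρ : ℕ → Measure ℕ}
    [∀ n, IsProbabilityMeasure (ρ n)] {ρ' : Measure ℕ} [IsProbabilityMeasure ρ']
    (h : ∀ z : ℂ, ‖z‖ = 1 → Tendsto (fun n => ∫ x, z ^ x ∂(ρ n)) atTop (𝓝 (∫ x, z ^ x ∂ρ')))
    (k : ℕ) : Tendsto (fun n => (ρ n).real {k}) atTop (𝓝 (ρ'.real {k})) := by
  have hπ : (2 * Real.pi : ℂ) ≠ 0 := by
    exact_mod_cast Real.two_pi_pos.ne'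
  have key : Tendsto (fun n => (2 * Real.pi : ℂ) * ((ρ n).real {k} : ℂ)) atTop
      (𝓝 ((2 * Real.pi : ℂ) * (ρ'.real {k} : ℂ))) := by
    simp_rw [two_pi_mul_real_singleton_eq_integral]
    have hk : ∀ t : ℝ, ‖Complex.exp (-(k * t * Complex.I))‖ = 1 := by
      intro t
      have := Complex.norm_exp_ofReal_mul_I (-(k * t))
      rw [← this]
      push_cast
      ring_nf
    have hmeas : ∀ σ : Measure ℕ, IsProbabilityMeasure σ → StronglyMeasurable
        (fun t : ℝ => ∫ x, Complex.exp (t * Complex.I) ^ x ∂σ) := by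
      intro σ hσ
      refine StronglyMeasurable.integral_prod_right
        (f := fun (t : ℝ) (x : ℕ) => Complex.exp (t * Complex.I) ^ x) ?_
      refine Measurable.stronglyMeasurable ?_
      refine measurable_from_prod_countable_left fun x => ?_
      simp only [Function.uncurry_apply_pair]
      fun_prop
    refine intervalIntegral.tendsto_integral_filter_of_dominated_convergence (fun _ => 1)
      (Filter.Eventually.of_forall fun n => ?_) (Filter.Eventually.of_forall fun n => ?_)
      (by simp) ?_
    · exact ((by fun_prop : Measurable fun t : ℝ =>
        Complex.exp (-(k * t * Complex.I))).stronglyMeasurable.mul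
          (hmeas (ρ n) inferInstance)).aestronglyMeasurable
    · refine Filter.Eventually.of_forall fun t _ => ?_
      rw [norm_mul, hk, one_mul]
      refine (norm_integral_le_integral_norm _).trans ?_
      simp [Complex.norm_exp_ofReal_mul_I]
    · refine Filter.Eventually.of_forall fun t _ => ?_
      exact (h _ (Complex.norm_exp_ofReal_mul_I t)).const_mul _
  have := (Complex.continuous_re.tendsto _).comp (key.const_mul ((2 * Real.pi : ℂ)⁻¹))
  simp only [Function.comp_def, inv_mul_cancel_left₀ hπ, Complex.ofReal_re] at this
  exact this

/-- A Markov-type bound of a point mass by an exponential moment. -/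
lemma pow_mul_real_singleton_le_integral {ρ : Measure ℕ} [IsFiniteMeasure ρ] {R : ℝ} (hR : 0 ≤ R)
    (hi : Integrable (fun x : ℕ => R ^ x) ρ) (k : ℕ) :
    R ^ k * ρ.real {k} ≤ ∫ x, R ^ x ∂ρ := by
  have h1 : ∫ x in {k}, R ^ x ∂ρ = R ^ k * ρ.real {k} := by
    rw [integral_singleton, smul_eq_mul, mul_comm]
  rw [← h1]
  exact setIntegral_le_integral hi (Filter.Eventually.of_forall fun x => pow_nonneg hR x)

/-- Any function of an a.s. finitely-valued random variable is integrable. -/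
lemma integrable_comp_of_mem_finset {Ω α E : Type*} [MeasurableSpace Ω] {μ : Measure Ω}
    [IsFiniteMeasure μ] [MeasurableSpace α] [DiscreteMeasurableSpace α] [Countable α]
    [NormedAddCommGroup E] {f : Ω → α} (hf : Measurable f) (s : Finset α)
    (hs : ∀ᵐ ω ∂μ, f ω ∈ s) (g : α → E) : Integrable (fun ω => g (f ω)) μ := by
  refine Integrable.of_bound (C := ∑ a ∈ s, ‖g a‖)
    (StronglyMeasurable.of_discrete.comp_measurable hf).aestronglyMeasurable ?_
  filter_upwards [hs] with ω hω
  exact Finset.single_le_sum (f := fun a => ‖g a‖) (fun _ _ => norm_nonneg _) hω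

/-! ### The compound Poisson distribution -/

instance isProbabilityMeasure_compoundPoisson (s : ℕ) (lam : ℕ → ℝ≥0) :
    IsProbabilityMeasure (compoundPoisson s lam) :=
  Measure.isProbabilityMeasure_map (Measurable.of_discrete).aemeasurable

lemma integrable_pow_poissonMeasure (r : ℝ≥0) (z : ℂ) :
    Integrable (fun x : ℕ => z ^ x) (poissonMeasure r) := by
  rw [integrable_poissonMeasure_iff]
  refine ((Real.summable_pow_div_factorial (r * ‖z‖)).mul_left (Real.exp (-r))).congr fun n => ?_
  rw [norm_pow, mul_pow]
  ring

lemma integral_pow_poissonMeasure (r : ℝ≥0) (z : ℂ) :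
    ∫ x, z ^ x ∂(poissonMeasure r) = Complex.exp (r * (z - 1)) := by
  rw [integral_poissonMeasure]
  have h1 : ∀ n : ℕ, (Real.exp (-r) * r ^ n / (n.factorial : ℝ)) • z ^ n
      = Complex.exp (-r) * ((r * z) ^ n / (n.factorial : ℂ)) := by
    intro n
    rw [Complex.real_smul, mul_pow]
    push_cast
    ring
  simp_rw [h1]
  rw [tsum_mul_left, (NormedSpace.expSeries_div_hasSum_exp (r * z)).tsum_eq,
    ← Complex.exp_eq_exp_ℂ, ← Complex.exp_add]
  ring_nf

lemma integrable_pow_compoundPoisson (s : ℕ) (lam : ℕ → ℝ≥0) (z : ℂ) :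
    Integrable (fun x : ℕ => z ^ x) (compoundPoisson s lam) := by
  rw [compoundPoisson, integrable_map_measure StronglyMeasurable.of_discrete.aestronglyMeasurable
    (Measurable.of_discrete).aemeasurable]
  simp only [Function.comp_def, ← Finset.prod_pow_eq_pow_sum, pow_mul]
  exact Integrable.fintype_prod (f := fun (i : Fin s) (x : ℕ) => (z ^ ((i : ℕ) + 1)) ^ x)
    fun i => integrable_pow_poissonMeasure _ _

lemma integral_pow_compoundPoisson (s : ℕ) (lam : ℕ → ℝ≥0) (z : ℂ) :
    ∫ x, z ^ x ∂(compoundPoisson s lam)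
      = Complex.exp (∑ l ∈ Finset.Icc 1 s, (lam l : ℂ) * (z ^ l - 1)) := by
  rw [compoundPoisson, integral_map (Measurable.of_discrete).aemeasurable
    StronglyMeasurable.of_discrete.aestronglyMeasurable]
  simp only [← Finset.prod_pow_eq_pow_sum, pow_mul]
  rw [integral_fintype_prod_eq_prod (fun (i : Fin s) (x : ℕ) => (z ^ ((i : ℕ) + 1)) ^ x)]
  simp_rw [integral_pow_poissonMeasure]
  rw [← Complex.exp_sum, Fin.sum_univ_eq_sum_range
    (fun i => (lam (i + 1) : ℂ) * (z ^ (i + 1) - 1)) s]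
  congr 1
  have := Finset.sum_range_succ_eq_add_sum_Icc (fun l => (lam l : ℂ) * (z ^ l - 1)) s
  rw [Finset.sum_range_succ'] at this
  simpa using this

/-! ### Elementary estimates -/

lemma norm_pow_sub_one_le_two_mul {z : ℂ} (hz : ‖z‖ = 1) (x : ℕ) : ‖z ^ x - 1‖ ≤ 2 * x := by
  rcases Nat.eq_zero_or_pos x with rfl | hx
  · simp
  · calc ‖z ^ x - 1‖ ≤ ‖z ^ x‖ + ‖(1 : ℂ)‖ := norm_sub_le _ _
      _ = 2 * 1 := by rw [norm_pow, hz]; norm_num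
      _ ≤ 2 * x := by gcongr; exact_mod_cast hx

lemma norm_exp_sub_one_le_one {a : ℂ} (ha : ‖a‖ ≤ 1) : ‖Complex.exp (a - 1)‖ ≤ 1 := by
  rw [Complex.norm_exp, Real.exp_le_one_iff]
  have := (Complex.re_le_norm a).trans ha
  simpa using this

lemma norm_sub_exp_sub_one_le {a : ℂ} (ha : ‖a‖ ≤ 1) :
    ‖a - Complex.exp (a - 1)‖ ≤ 2 * ‖a - 1‖ ^ 2 := by
  -- For `‖a - 1‖ ≥ 1` both terms have norm at most `1`, so no smallness assumption is needed.
  rcases le_total ‖a - 1‖ 1 with h | h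
  · have := Complex.norm_exp_sub_one_sub_id_le h
    rw [norm_sub_rev]
    calc _ = ‖Complex.exp (a - 1) - 1 - (a - 1)‖ := by ring_nf
      _ ≤ ‖a - 1‖ ^ 2 := this
      _ ≤ _ := by nlinarith [sq_nonneg ‖a - 1‖]
  · have := norm_sub_le a (Complex.exp (a - 1))
    have := norm_exp_sub_one_le_one ha
    nlinarith

lemma pow_eq_sum_sub_one_pow_mul_choose (z : ℂ) (x : ℕ) :
    z ^ x = ∑ m ∈ Finset.range (x + 1), (z - 1) ^ m * (x.choose m : ℂ) := by
  have := add_pow (z - 1) 1 x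
  simpa using this

/-- The expansion of `z ^ x` at `z = 1` truncated at order `s` is exact for `x ≤ s`, and otherwise
the falling factorial on the right is at least `1`. -/
lemma norm_pow_sub_sum_choose_le {z : ℂ} (hz : ‖z‖ = 1) {x C : ℕ} (hx : x ≤ C) (s : ℕ) :
    ‖z ^ x - ∑ m ∈ Finset.range (s + 1), (z - 1) ^ m * (x.choose m : ℂ)‖
      ≤ 2 * 3 ^ C * (x.descFactorial (s + 1) : ℝ) := by
  rcases Nat.lt_or_ge s x with h | h
  · have hd : (1 : ℝ) ≤ (x.descFactorial (s + 1) : ℝ) := by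
      exact_mod_cast Nat.pos_of_ne_zero fun h0 => by
        rw [Nat.descFactorial_eq_zero_iff_lt] at h0; omega
    have h2 : ‖z - 1‖ ≤ 2 := by
      have := norm_sub_le z 1
      rw [hz, norm_one] at this
      linarith
    have h3 : ‖∑ m ∈ Finset.range (s + 1), (z - 1) ^ m * (x.choose m : ℂ)‖ ≤ 3 ^ x := by
      calc _ ≤ ∑ m ∈ Finset.range (s + 1), ‖(z - 1) ^ m * (x.choose m : ℂ)‖ := norm_sum_le _ _
        _ ≤ ∑ m ∈ Finset.range (s + 1), (2 : ℝ) ^ m * (x.choose m : ℝ) := by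
            gcongr with m _
            rw [norm_mul, norm_pow, Complex.norm_natCast]
            gcongr
        _ ≤ ∑ m ∈ Finset.range (x + 1), (2 : ℝ) ^ m * (x.choose m : ℝ) :=
            Finset.sum_le_sum_of_subset_of_nonneg (Finset.range_mono (by omega))
              fun _ _ _ => by positivity
        _ = 3 ^ x := by
            have := add_pow (2 : ℝ) 1 x
            norm_num at this
            exact this.symm
    have h4 : (3 : ℝ) ^ x ≤ 3 ^ C := pow_le_pow_right₀ (by norm_num) hx
    have h5 : (1 : ℝ) ≤ 3 ^ C := one_le_pow₀ (by norm_num)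
    calc _ ≤ ‖z ^ x‖ + ‖∑ m ∈ Finset.range (s + 1), (z - 1) ^ m * (x.choose m : ℂ)‖ :=
          norm_sub_le _ _
      _ ≤ 1 + 3 ^ x := by rw [norm_pow, hz, one_pow]; gcongr
      _ ≤ 2 * 3 ^ C * 1 := by linarith
      _ ≤ _ := by gcongr
  · have : ∑ m ∈ Finset.range (s + 1), (z - 1) ^ m * (x.choose m : ℂ) = z ^ x := by
      rw [pow_eq_sum_sub_one_pow_mul_choose z x]
      refine (Finset.sum_subset (Finset.range_mono (by omega)) fun m _ hm => ?_).symm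
      rw [Nat.choose_eq_zero_of_lt (by simpa using hm)]
      simp
    rw [this, sub_self, norm_zero]
    positivity

lemma pow_le_one_add_mul {w : ℝ} (hw : 1 ≤ w) {x C : ℕ} (hx : x ≤ C) :
    w ^ x ≤ 1 + w ^ C * x := by
  rcases Nat.eq_zero_or_pos x with rfl | h
  · simp
  · have h1 : w ^ x ≤ w ^ C := pow_le_pow_right₀ hw hx
    have h2 : (1 : ℝ) ≤ x := by exact_mod_cast h
    have h3 : 0 ≤ w ^ C := by positivity
    nlinarith

/-! ### Measurability with respect to initial segments -/

lemma measurable_iSup_comap {Ω : Type*} {X : ℕ → Ω → ℕ} {k i : ℕ} (hi : i ∈ Set.Icc 1 k) :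
    Measurable[⨆ i ∈ Set.Icc 1 k, MeasurableSpace.comap (X i) inferInstance] (X i) :=
  measurable_iff_comap_le.2
    (le_iSup₂_of_le (f := fun i (_ : i ∈ Set.Icc 1 k) =>
      MeasurableSpace.comap (X i) inferInstance) i hi le_rfl)

/-- The sum `X k + X (k - 2) + X (k - 4) + ⋯` over the positive indices of the same parity as `k`.
The two such sums ending at `k` and `k + 1` add up to the full sum. -/
def alternatingSum {Ω : Type*} (X : ℕ → Ω → ℕ) : ℕ → Ω → ℕ
  | 0 => fun _ => 0
  | 1 => X 1
  | k + 2 => fun ω => alternatingSum X k ω + X (k + 2) ω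

lemma alternatingSum_succ_add {Ω : Type*} (X : ℕ → Ω → ℕ) (k : ℕ) (ω : Ω) :
    alternatingSum X (k + 1) ω + alternatingSum X k ω = ∑ i ∈ Finset.Icc 1 (k + 1), X i ω := by
  induction k with
  | zero => simp [alternatingSum]
  | succ k ih =>
    rw [Finset.sum_Icc_succ_top (by omega), ← ih, alternatingSum]
    ring

lemma measurable_iSup_comap_alternatingSum {Ω : Type*} (X : ℕ → Ω → ℕ) (k l : ℕ) (hkl : k ≤ l) :
    Measurable[⨆ i ∈ Set.Icc 1 l, MeasurableSpace.comap (X i) inferInstance]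
      (alternatingSum X k) := by
  -- Making the generated sigma-algebra the instance lets `Measurable.add` apply.
  let _ : MeasurableSpace Ω := ⨆ i ∈ Set.Icc 1 l, MeasurableSpace.comap (X i) inferInstance
  have hX : ∀ i ∈ Set.Icc 1 l, Measurable (X i) := fun i hi => measurable_iSup_comap hi
  induction k using alternatingSum.induct with
  | case1 => exact measurable_const
  | case2 => exact hX 1 ⟨le_rfl, hkl⟩
  | case3 k ih => exact (ih (by omega)).add (hX (k + 2) ⟨by omega, hkl⟩)

/-! ### Bounded `1`-dependent variables -/

section Row

variable {Ω : Type*} [MeasurableSpace Ω] {μ : Measure Ω} {X : ℕ → Ω → ℕ} {n C : ℕ}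

lemma factorialMoment_nonneg (j : ℕ) (Y : Ω → ℕ) : 0 ≤ factorialMoment j Y μ :=
  integral_nonneg fun _ => by positivity

lemma factorialMoment_one (Y : Ω → ℕ) : factorialMoment 1 Y μ = ∫ ω, (Y ω : ℝ) ∂μ := by
  simp [factorialMoment]

lemma IsMDependent.indepFun_of_measurable (hd : IsMDependent 1 n X μ) {k : ℕ} (hk : 1 ≤ k)
    (hkn : k + 2 ≤ n) {f : Ω → ℕ}
    (hf : Measurable[⨆ i ∈ Set.Icc 1 k, MeasurableSpace.comap (X i) inferInstance] f) :
    IndepFun f (X (k + 2)) μ := by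
  rw [IndepFun_iff_Indep]
  refine indep_of_indep_of_le (hd k (k + 2) hk (by omega) hkn) hf.comap_le ?_
  exact le_iSup₂_of_le (k + 2) ⟨le_rfl, hkn⟩ le_rfl

lemma IsMDependent.indepFun_sum (hd : IsMDependent 1 n X μ) {k : ℕ} (hk : 1 ≤ k)
    (hkn : k + 2 ≤ n) : IndepFun (fun ω => ∑ i ∈ Finset.Icc 1 k, X i ω) (X (k + 2)) μ :=
  hd.indepFun_of_measurable hk hkn <| Finset.measurable_fun_sum _ fun i hi =>
    measurable_iSup_comap (by simpa using hi)

lemma sum_Icc_le_mul {x : ℕ → ℕ} {k : ℕ} (hkn : k ≤ n)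
    (hb : ∀ i ∈ Finset.Icc 1 n, x i ≤ C) : ∑ i ∈ Finset.Icc 1 k, x i ≤ k * C := by
  have := Finset.sum_le_card_nsmul (Finset.Icc 1 k) x C fun i hi =>
    hb i (Finset.Icc_subset_Icc_right hkn hi)
  simpa using this

lemma measurable_sum_Icc (hm : ∀ i ∈ Finset.Icc 1 n, Measurable (X i)) {k : ℕ} (hkn : k ≤ n) :
    Measurable fun ω => ∑ i ∈ Finset.Icc 1 k, X i ω :=
  Finset.measurable_fun_sum _ fun i hi => hm i (Finset.Icc_subset_Icc_right hkn hi)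

variable [IsProbabilityMeasure μ]

lemma integrable_comp_of_le {E : Type*} [NormedAddCommGroup E] {Y : Ω → ℕ} (hY : Measurable Y)
    (hb : ∀ᵐ ω ∂μ, Y ω ≤ C) (g : ℕ → E) : Integrable (fun ω => g (Y ω)) μ :=
  integrable_comp_of_mem_finset hY (Finset.Iic C) (hb.mono fun _ h => Finset.mem_Iic.2 h) g

lemma integrable_comp_sum {E : Type*} [NormedAddCommGroup E]
    (hm : ∀ i ∈ Finset.Icc 1 n, Measurable (X i))
    (hb : ∀ᵐ ω ∂μ, ∀ i ∈ Finset.Icc 1 n, X i ω ≤ C) {k : ℕ} (hkn : k ≤ n) (g : ℕ → E) :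
    Integrable (fun ω => g (∑ i ∈ Finset.Icc 1 k, X i ω)) μ :=
  integrable_comp_of_le (measurable_sum_Icc hm hkn)
    (hb.mono fun _ h => sum_Icc_le_mul hkn h) g

lemma integrable_comp_sum_last_two {E : Type*} [NormedAddCommGroup E]
    (hm : ∀ i ∈ Finset.Icc 1 n, Measurable (X i))
    (hb : ∀ᵐ ω ∂μ, ∀ i ∈ Finset.Icc 1 n, X i ω ≤ C) {k : ℕ} (hkn : k + 2 ≤ n)
    (g : ℕ → ℕ → ℕ → E) :
    Integrable (fun ω => g (∑ i ∈ Finset.Icc 1 k, X i ω) (X (k + 1) ω) (X (k + 2) ω)) μ := by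
  have h1 : k + 1 ∈ Finset.Icc 1 n := Finset.mem_Icc.2 (by omega)
  have h2 : k + 2 ∈ Finset.Icc 1 n := Finset.mem_Icc.2 (by omega)
  refine integrable_comp_of_mem_finset (α := ℕ × ℕ × ℕ)
    (f := fun ω => (∑ i ∈ Finset.Icc 1 k, X i ω, X (k + 1) ω, X (k + 2) ω))
    ((measurable_sum_Icc hm (by omega)).prodMk ((hm _ h1).prodMk (hm _ h2)))
    (Finset.Iic (k * C) ×ˢ Finset.Iic C ×ˢ Finset.Iic C) ?_ (fun p => g p.1 p.2.1 p.2.2)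
  filter_upwards [hb] with ω hω
  simp only [Finset.mem_product, Finset.mem_Iic]
  exact ⟨sum_Icc_le_mul (by omega) hω, hω _ h1, hω _ h2⟩

/-! ### Generating functions on the unit circle -/

lemma norm_integral_pow_le_one {z : ℂ} (hz : ‖z‖ = 1) (Y : Ω → ℕ) :
    ‖∫ ω, z ^ Y ω ∂μ‖ ≤ 1 := by
  refine (norm_integral_le_integral_norm _).trans ?_
  simp [hz]

lemma norm_integral_pow_sub_one_le {z : ℂ} (hz : ‖z‖ = 1) {Y : Ω → ℕ} (hY : Measurable Y)
    (hb : ∀ᵐ ω ∂μ, Y ω ≤ C) : ‖∫ ω, z ^ Y ω ∂μ - 1‖ ≤ 2 * factorialMoment 1 Y μ := by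
  have h1 : ∫ ω, z ^ Y ω ∂μ - 1 = ∫ ω, (z ^ Y ω - 1) ∂μ := by
    rw [integral_sub (integrable_comp_of_le hY hb fun x => z ^ x) (integrable_const _)]
    simp
  rw [h1, factorialMoment_one, ← integral_const_mul]
  exact norm_integral_le_of_norm_le (integrable_comp_of_le hY hb fun x => 2 * (x : ℝ))
    (Filter.Eventually.of_forall fun ω => norm_pow_sub_one_le_two_mul hz _)

/-- Appending one variable to a `1`-dependent sum multiplies its generating function by that of the
variable, up to an error governed by the two last variables: expand `z ^ X (k + 1)` around `1` and
use that `X (k + 2)` is independent of the first `k` variables. -/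
lemma IsMDependent.norm_integral_pow_sum_sub_mul_le (hd : IsMDependent 1 n X μ)
    (hm : ∀ i ∈ Finset.Icc 1 n, Measurable (X i))
    (hb : ∀ᵐ ω ∂μ, ∀ i ∈ Finset.Icc 1 n, X i ω ≤ C) {z : ℂ} (hz : ‖z‖ = 1) {k : ℕ}
    (hkn : k + 2 ≤ n) :
    ‖∫ ω, z ^ (∑ i ∈ Finset.Icc 1 (k + 2), X i ω) ∂μ
        - (∫ ω, z ^ (∑ i ∈ Finset.Icc 1 (k + 1), X i ω) ∂μ) * ∫ ω, z ^ X (k + 2) ω ∂μ‖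
      ≤ 4 * ∫ ω, (X (k + 1) ω : ℝ) * X (k + 2) ω ∂μ
        + 4 * (factorialMoment 1 (X (k + 1)) μ * factorialMoment 1 (X (k + 2)) μ) := by
  have h1 : k + 1 ∈ Finset.Icc 1 n := Finset.mem_Icc.2 (by omega)
  have h2 : k + 2 ∈ Finset.Icc 1 n := Finset.mem_Icc.2 (by omega)
  have hb2 : ∀ᵐ ω ∂μ, X (k + 2) ω ≤ C := hb.mono fun ω h => h _ h2
  set a := ∫ ω, z ^ X (k + 2) ω ∂μ with ha
  set S : Ω → ℕ := fun ω => ∑ i ∈ Finset.Icc 1 k, X i ω with hS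
  have hint := fun g : ℕ → ℕ → ℕ → ℂ => integrable_comp_sum_last_two hm hb hkn g
  have hsum1 : ∀ ω, ∑ i ∈ Finset.Icc 1 (k + 1), X i ω = S ω + X (k + 1) ω := fun ω =>
    Finset.sum_Icc_succ_top (by omega) _
  have hsum2 : ∀ ω, ∑ i ∈ Finset.Icc 1 (k + 2), X i ω = S ω + X (k + 1) ω + X (k + 2) ω :=
    fun ω => by rw [Finset.sum_Icc_succ_top (by omega), hsum1]
  have ha1 : ∫ ω, (z ^ X (k + 2) ω - 1) ∂μ = a - 1 := by
    rw [integral_sub (integrable_comp_of_le (hm _ h2) hb2 fun x => z ^ x) (integrable_const _)]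
    simp [ha]
  have hindep : ∫ ω, z ^ S ω * (z ^ X (k + 2) ω - 1) ∂μ = (∫ ω, z ^ S ω ∂μ) * (a - 1) := by
    -- For `k = 0` the sum is empty, a case which the definition of `m`-dependence leaves out.
    rcases Nat.eq_zero_or_pos k with rfl | hk
    · simp [hS, ha1]
    · rw [← ha1]
      refine IndepFun.integral_fun_mul_eq_mul_integral
        ((hd.indepFun_sum hk hkn).comp (φ := fun x => z ^ x) (ψ := fun x => z ^ x - 1)
          Measurable.of_discrete Measurable.of_discrete) ?_ ?_
      · exact (integrable_comp_sum hm hb (by omega) fun x => z ^ x).aestronglyMeasurable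
      · exact (integrable_comp_of_le (hm _ h2) hb2 fun x => z ^ x - 1).aestronglyMeasurable
  have hS1 : ∫ ω, z ^ (S ω + X (k + 1) ω) ∂μ - ∫ ω, z ^ S ω ∂μ
      = ∫ ω, z ^ S ω * (z ^ X (k + 1) ω - 1) ∂μ := by
    rw [← integral_sub (hint fun s x _ => z ^ (s + x)) (hint fun s _ _ => z ^ s)]
    congr 1 with ω
    simp only [hS, pow_add]
    ring
  -- With `u = z ^ X (k + 1)` and `v = z ^ X (k + 2)`: `u v = u + (v - 1) + (u - 1) (v - 1)`.
  have hsplit : ∫ ω, z ^ (S ω + X (k + 1) ω + X (k + 2) ω) ∂μ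
      = ∫ ω, z ^ (S ω + X (k + 1) ω) ∂μ + ∫ ω, z ^ S ω * (z ^ X (k + 2) ω - 1) ∂μ
        + ∫ ω, z ^ S ω * (z ^ X (k + 1) ω - 1) * (z ^ X (k + 2) ω - 1) ∂μ := by
    rw [← integral_add (hint fun s x _ => z ^ (s + x)) (hint fun s _ y => z ^ s * (z ^ y - 1)),
      ← integral_add
        (f := fun ω => z ^ (S ω + X (k + 1) ω) + z ^ S ω * (z ^ X (k + 2) ω - 1))
        (hint fun s x y => z ^ (s + x) + z ^ s * (z ^ y - 1))
        (hint fun s x y => z ^ s * (z ^ x - 1) * (z ^ y - 1))]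
    congr 1 with ω
    simp only [pow_add]
    ring
  have hA : ‖∫ ω, z ^ S ω * (z ^ X (k + 1) ω - 1) * (z ^ X (k + 2) ω - 1) ∂μ‖
      ≤ 4 * ∫ ω, (X (k + 1) ω : ℝ) * X (k + 2) ω ∂μ := by
    rw [← integral_const_mul]
    refine norm_integral_le_of_norm_le (integrable_comp_sum_last_two hm hb hkn
      fun _ x y => 4 * ((x : ℝ) * y)) (Filter.Eventually.of_forall fun ω => ?_)
    rw [norm_mul, norm_mul, norm_pow, hz, one_pow, one_mul]
    calc _ ≤ (2 * (X (k + 1) ω : ℝ)) * (2 * X (k + 2) ω) := by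
          gcongr <;> exact norm_pow_sub_one_le_two_mul hz _
      _ = _ := by ring
  have hB : ‖∫ ω, z ^ S ω * (z ^ X (k + 1) ω - 1) ∂μ‖ ≤ 2 * factorialMoment 1 (X (k + 1)) μ := by
    rw [factorialMoment_one, ← integral_const_mul]
    refine norm_integral_le_of_norm_le (integrable_comp_sum_last_two hm hb hkn
      fun _ x _ => 2 * (x : ℝ)) (Filter.Eventually.of_forall fun ω => ?_)
    rw [norm_mul, norm_pow, hz, one_pow, one_mul]
    exact norm_pow_sub_one_le_two_mul hz _
  have hC := norm_integral_pow_sub_one_le hz (hm _ h2) hb2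
  simp_rw [hsum1, hsum2]
  rw [hsplit, hindep]
  calc _ = ‖∫ ω, z ^ S ω * (z ^ X (k + 1) ω - 1) * (z ^ X (k + 2) ω - 1) ∂μ
          - (∫ ω, z ^ S ω * (z ^ X (k + 1) ω - 1) ∂μ) * (a - 1)‖ := by
        rw [← hS1]; ring_nf
    _ ≤ 4 * ∫ ω, (X (k + 1) ω : ℝ) * X (k + 2) ω ∂μ
        + (2 * factorialMoment 1 (X (k + 1)) μ) * (2 * factorialMoment 1 (X (k + 2)) μ) := by
        refine (norm_sub_le _ _).trans (add_le_add hA ?_)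
        rw [norm_mul]
        exact mul_le_mul hB hC (norm_nonneg _)
          (mul_nonneg two_pos.le (factorialMoment_nonneg 1 _))
    _ = _ := by ring

lemma integral_mul_le_abs_covariance_add {Y Z : Ω → ℕ} (hY : Measurable Y) (hZ : Measurable Z)
    (hYb : ∀ᵐ ω ∂μ, Y ω ≤ C) (hZb : ∀ᵐ ω ∂μ, Z ω ≤ C) :
    ∫ ω, (Y ω : ℝ) * Z ω ∂μ ≤ |covariance (fun ω => (Y ω : ℝ)) (fun ω => (Z ω : ℝ)) μ|
      + factorialMoment 1 Y μ * factorialMoment 1 Z μ := by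
  have hLp : ∀ W : Ω → ℕ, Measurable W → (∀ᵐ ω ∂μ, W ω ≤ C) →
      MemLp (fun ω => (W ω : ℝ)) 2 μ := fun W hW hWb =>
    MemLp.of_bound (measurable_from_nat.comp hW).aestronglyMeasurable C
      (hWb.mono fun ω h => by simpa using h)
  rw [covariance_eq_sub (hLp Y hY hYb) (hLp Z hZ hZb), factorialMoment_one, factorialMoment_one]
  have := le_abs_self (μ[(fun ω => (Y ω : ℝ)) * fun ω => (Z ω : ℝ)]
    - (∫ ω, (Y ω : ℝ) ∂μ) * ∫ ω, (Z ω : ℝ) ∂μ)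
  simp only [Pi.mul_apply] at this ⊢
  linarith

/-- The generating function of a `1`-dependent sum is close to that of the compound Poisson law
whose jump intensities are the sums over `j` of the point masses of the laws of `X j`. -/
lemma IsMDependent.norm_integral_pow_sum_sub_exp_le (hd : IsMDependent 1 n X μ)
    (hm : ∀ i ∈ Finset.Icc 1 n, Measurable (X i))
    (hb : ∀ᵐ ω ∂μ, ∀ i ∈ Finset.Icc 1 n, X i ω ≤ C) {z : ℂ} (hz : ‖z‖ = 1) {M : ℝ}
    (hM : ∀ i ∈ Finset.Icc 1 n, factorialMoment 1 (X i) μ ≤ M) {k : ℕ} (hkn : k ≤ n) :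
    ‖∫ ω, z ^ (∑ i ∈ Finset.Icc 1 k, X i ω) ∂μ
        - Complex.exp (∑ j ∈ Finset.Icc 1 k, (∫ ω, z ^ X j ω ∂μ - 1))‖
      ≤ 4 * ∑ j ∈ Finset.Icc 2 k,
          |covariance (fun ω => (X (j - 1) ω : ℝ)) (fun ω => (X j ω : ℝ)) μ|
        + 16 * M * ∑ j ∈ Finset.Icc 1 k, factorialMoment 1 (X j) μ := by
  have hsq : ∀ j ∈ Finset.Icc 1 n, ‖∫ ω, z ^ X j ω ∂μ - Complex.exp (∫ ω, z ^ X j ω ∂μ - 1)‖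
      ≤ 8 * M * factorialMoment 1 (X j) μ := by
    intro j hj
    have h1 := norm_sub_exp_sub_one_le (norm_integral_pow_le_one (μ := μ) hz (X j))
    have h2 := norm_integral_pow_sub_one_le hz (hm j hj) (hb.mono fun ω h => h j hj)
    have h3 := hM j hj
    have h4 : 0 ≤ factorialMoment 1 (X j) μ := factorialMoment_nonneg 1 (X j)
    have h5 : ‖∫ ω, z ^ X j ω ∂μ - 1‖ ^ 2 ≤ (2 * factorialMoment 1 (X j) μ) ^ 2 := by gcongr
    nlinarith
  induction k with
  | zero => simp
  | succ k ih =>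
    have hk1 : k + 1 ∈ Finset.Icc 1 n := Finset.mem_Icc.2 (by omega)
    have hν : 0 ≤ factorialMoment 1 (X (k + 1)) μ := factorialMoment_nonneg 1 (X (k + 1))
    have hM0 : 0 ≤ M := hν.trans (hM _ hk1)
    rcases k with _ | k
    · have := hsq 1 hk1
      simp only [zero_add, Finset.Icc_self, Finset.sum_singleton] at hν ⊢
      simp only [show Finset.Icc 2 1 = ∅ from rfl, Finset.sum_empty]
      nlinarith [mul_nonneg hM0 hν]
    · have hk0 : k + 1 ∈ Finset.Icc 1 n := Finset.mem_Icc.2 (by omega)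
      have ih := ih (by omega)
      have hstep := hd.norm_integral_pow_sum_sub_mul_le hm hb hz (k := k) (by omega)
      have hcov := integral_mul_le_abs_covariance_add (hm _ hk0) (hm _ hk1)
        (hb.mono fun ω h => h _ hk0) (hb.mono fun ω h => h _ hk1)
      have hMν : factorialMoment 1 (X (k + 1)) μ * factorialMoment 1 (X (k + 2)) μ
          ≤ M * factorialMoment 1 (X (k + 2)) μ := by gcongr; exact hM _ hk0
      have hsq' := hsq _ hk1
      simp only [add_assoc, Nat.reduceAdd] at hsq' hcov hν ⊢
      rw [Finset.sum_Icc_succ_top (b := k + 1) (by omega)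
          (fun j => (∫ ω, z ^ X j ω ∂μ - 1)),
        Finset.sum_Icc_succ_top (b := k + 1) (by omega)
          (fun j => |covariance (fun ω => (X (j - 1) ω : ℝ)) (fun ω => (X j ω : ℝ)) μ|),
        Finset.sum_Icc_succ_top (b := k + 1) (by omega) (fun j => factorialMoment 1 (X j) μ),
        Complex.exp_add]
      simp only [add_assoc, Nat.reduceAdd, show k + 2 - 1 = k + 1 by omega]
      set φ2 := ∫ ω, z ^ (∑ i ∈ Finset.Icc 1 (k + 2), X i ω) ∂μ
      set φ1 := ∫ ω, z ^ (∑ i ∈ Finset.Icc 1 (k + 1), X i ω) ∂μ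
      set a := ∫ ω, z ^ X (k + 2) ω ∂μ
      set e := Complex.exp (∑ j ∈ Finset.Icc 1 (k + 1), (∫ ω, z ^ X j ω ∂μ - 1))
      have hφ : ‖φ1‖ ≤ 1 := norm_integral_pow_le_one hz _
      have hea : ‖Complex.exp (a - 1)‖ ≤ 1 :=
        norm_exp_sub_one_le_one (norm_integral_pow_le_one hz _)
      have htri : ‖φ2 - e * Complex.exp (a - 1)‖ ≤ ‖φ2 - φ1 * a‖ + ‖a - Complex.exp (a - 1)‖
          + ‖φ1 - e‖ := by
        calc _ = ‖(φ2 - φ1 * a) + φ1 * (a - Complex.exp (a - 1))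
              + (φ1 - e) * Complex.exp (a - 1)‖ := by ring_nf
          _ ≤ ‖φ2 - φ1 * a‖ + ‖φ1‖ * ‖a - Complex.exp (a - 1)‖
              + ‖φ1 - e‖ * ‖Complex.exp (a - 1)‖ := by
            rw [← norm_mul, ← norm_mul]
            exact norm_add₃_le
          _ ≤ ‖φ2 - φ1 * a‖ + 1 * ‖a - Complex.exp (a - 1)‖ + ‖φ1 - e‖ * 1 := by gcongr
          _ = _ := by ring
      linarith

/-! ### Expansion in factorial moments -/

lemma norm_integral_pow_sub_sum_factorialMoment_le {z : ℂ} (hz : ‖z‖ = 1) {Y : Ω → ℕ}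
    (hY : Measurable Y) (hb : ∀ᵐ ω ∂μ, Y ω ≤ C) (s : ℕ) :
    ‖(∫ ω, z ^ Y ω ∂μ - 1) - ∑ m ∈ Finset.Icc 1 s,
        (z - 1) ^ m * ((1 / (m.factorial : ℝ) * factorialMoment m Y μ : ℝ) : ℂ)‖
      ≤ 2 * 3 ^ C * factorialMoment (s + 1) Y μ := by
  have hmom : ∀ m, ((1 / (m.factorial : ℝ) * factorialMoment m Y μ : ℝ) : ℂ)
      = ∫ ω, ((Y ω).choose m : ℂ) ∂μ := by
    intro m
    have h1 : ∀ x : ℕ, (x.choose m : ℂ)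
        = ((1 / (m.factorial : ℝ) * (x.descFactorial m : ℝ) : ℝ) : ℂ) := by
      intro x
      rw [Nat.descFactorial_eq_factorial_mul_choose]
      have : (m.factorial : ℂ) ≠ 0 := by exact_mod_cast m.factorial_ne_zero
      push_cast
      field_simp
    simp_rw [h1]
    rw [integral_complex_ofReal, integral_const_mul, factorialMoment]
  have hcomb : (∫ ω, z ^ Y ω ∂μ - 1) - ∑ m ∈ Finset.Icc 1 s,
        (z - 1) ^ m * ((1 / (m.factorial : ℝ) * factorialMoment m Y μ : ℝ) : ℂ)
      = ∫ ω, (z ^ Y ω - ∑ m ∈ Finset.range (s + 1), (z - 1) ^ m * ((Y ω).choose m : ℂ)) ∂μ := by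
    rw [integral_sub (integrable_comp_of_le hY hb fun x => z ^ x)
      (integrable_comp_of_le hY hb fun x =>
        ∑ m ∈ Finset.range (s + 1), (z - 1) ^ m * (x.choose m : ℂ)),
      integral_finsetSum _ fun m _ =>
        integrable_comp_of_le hY hb fun x => (z - 1) ^ m * (x.choose m : ℂ)]
    simp_rw [integral_const_mul, ← hmom]
    rw [Finset.sum_range_succ_eq_add_sum_Icc]
    simp [factorialMoment, sub_sub]
  rw [hcomb, factorialMoment, ← integral_const_mul]
  refine norm_integral_le_of_norm_le
    (integrable_comp_of_le hY hb fun x => 2 * 3 ^ C * (x.descFactorial (s + 1) : ℝ)) ?_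
  filter_upwards [hb] with ω hω
  exact norm_pow_sub_sum_choose_le hz hω s

lemma norm_sum_integral_pow_sub_sum_factorialMoment_le
    (hm : ∀ i ∈ Finset.Icc 1 n, Measurable (X i))
    (hb : ∀ᵐ ω ∂μ, ∀ i ∈ Finset.Icc 1 n, X i ω ≤ C) {z : ℂ} (hz : ‖z‖ = 1) (s : ℕ) :
    ‖∑ j ∈ Finset.Icc 1 n, (∫ ω, z ^ X j ω ∂μ - 1) - ∑ m ∈ Finset.Icc 1 s, (z - 1) ^ m *
        ((1 / (m.factorial : ℝ) * ∑ j ∈ Finset.Icc 1 n, factorialMoment m (X j) μ : ℝ) : ℂ)‖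
      ≤ 2 * 3 ^ C * ∑ j ∈ Finset.Icc 1 n, factorialMoment (s + 1) (X j) μ := by
  have h1 : ∑ m ∈ Finset.Icc 1 s, (z - 1) ^ m *
        ((1 / (m.factorial : ℝ) * ∑ j ∈ Finset.Icc 1 n, factorialMoment m (X j) μ : ℝ) : ℂ)
      = ∑ j ∈ Finset.Icc 1 n, ∑ m ∈ Finset.Icc 1 s, (z - 1) ^ m *
        ((1 / (m.factorial : ℝ) * factorialMoment m (X j) μ : ℝ) : ℂ) := by
    rw [Finset.sum_comm]
    refine Finset.sum_congr rfl fun m _ => ?_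
    rw [Finset.mul_sum, Complex.ofReal_sum, Finset.mul_sum]
  rw [h1, ← Finset.sum_sub_distrib, Finset.mul_sum]
  exact norm_sum_le_of_le _ fun j hj => norm_integral_pow_sub_sum_factorialMoment_le hz (hm j hj)
    (hb.mono fun ω h => h j hj) s

end Row

/-! ### Exponential moments -/

lemma alternatingSum_le_mul {Ω : Type*} {X : ℕ → Ω → ℕ} {n C k : ℕ} (hkn : k ≤ n) {ω : Ω}
    (hb : ∀ i ∈ Finset.Icc 1 n, X i ω ≤ C) : alternatingSum X k ω ≤ k * C := by
  rcases k with _ | k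
  · simp [alternatingSum]
  · calc _ ≤ alternatingSum X (k + 1) ω + alternatingSum X k ω := Nat.le_add_right _ _
      _ = ∑ i ∈ Finset.Icc 1 (k + 1), X i ω := alternatingSum_succ_add X k ω
      _ ≤ _ := sum_Icc_le_mul (x := fun i => X i ω) hkn hb

section Row

variable {Ω : Type*} [MeasurableSpace Ω] {μ : Measure Ω} {X : ℕ → Ω → ℕ} {n C : ℕ}

lemma measurable_alternatingSum (hm : ∀ i ∈ Finset.Icc 1 n, Measurable (X i)) {k : ℕ}
    (hkn : k ≤ n) : Measurable (alternatingSum X k) :=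
  (measurable_iSup_comap_alternatingSum X k n hkn).mono
    (iSup₂_le fun i hi => (hm i (by simpa using hi)).comap_le) le_rfl

variable [IsProbabilityMeasure μ]

lemma integral_pow_le_exp {w : ℝ} (hw : 1 ≤ w) {Y : Ω → ℕ} (hY : Measurable Y)
    (hb : ∀ᵐ ω ∂μ, Y ω ≤ C) :
    ∫ ω, w ^ Y ω ∂μ ≤ Real.exp (w ^ C * factorialMoment 1 Y μ) := by
  calc ∫ ω, w ^ Y ω ∂μ ≤ ∫ ω, (1 + w ^ C * (Y ω : ℝ)) ∂μ :=
        integral_mono_ae (integrable_comp_of_le hY hb fun x => w ^ x)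
          (integrable_comp_of_le hY hb fun x => 1 + w ^ C * (x : ℝ))
          (hb.mono fun ω h => pow_le_one_add_mul hw h)
    _ = w ^ C * factorialMoment 1 Y μ + 1 := by
        rw [integral_add (integrable_const _)
          (integrable_comp_of_le hY hb fun x => w ^ C * (x : ℝ)), integral_const_mul,
          factorialMoment_one]
        simp [add_comm]
    _ ≤ _ := Real.add_one_le_exp _

/-- The summands of an alternating sum of `1`-dependent variables are independent, so that its
exponential moments factorize; each factor is at most `1 + w ^ C * E (X j)`. -/
lemma IsMDependent.integral_pow_alternatingSum_le (hd : IsMDependent 1 n X μ)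
    (hm : ∀ i ∈ Finset.Icc 1 n, Measurable (X i))
    (hb : ∀ᵐ ω ∂μ, ∀ i ∈ Finset.Icc 1 n, X i ω ≤ C) {w : ℝ} (hw : 1 ≤ w) {k : ℕ} (hkn : k ≤ n) :
    ∫ ω, w ^ alternatingSum X k ω ∂μ
      ≤ Real.exp (w ^ C * ∑ j ∈ Finset.Icc 1 k, factorialMoment 1 (X j) μ) := by
  induction k using alternatingSum.induct with
  | case1 => simp [alternatingSum]
  | case2 =>
    have h1 : 1 ∈ Finset.Icc 1 n := Finset.mem_Icc.2 ⟨le_rfl, hkn⟩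
    simpa [alternatingSum] using integral_pow_le_exp hw (hm 1 h1) (hb.mono fun ω h => h 1 h1)
  | case3 k ih =>
    have h2 : k + 2 ∈ Finset.Icc 1 n := Finset.mem_Icc.2 ⟨by omega, hkn⟩
    have hb2 : ∀ᵐ ω ∂μ, X (k + 2) ω ≤ C := hb.mono fun ω h => h _ h2
    have hw0 : (0 : ℝ) ≤ w := by linarith
    have hprod : ∫ ω, w ^ alternatingSum X (k + 2) ω ∂μ
        = (∫ ω, w ^ alternatingSum X k ω ∂μ) * ∫ ω, w ^ X (k + 2) ω ∂μ := by
      simp only [alternatingSum, pow_add]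
      rcases Nat.eq_zero_or_pos k with rfl | hk
      · simp [alternatingSum]
      · refine IndepFun.integral_fun_mul_eq_mul_integral
          ((hd.indepFun_of_measurable hk hkn
            (measurable_iSup_comap_alternatingSum X k k le_rfl)).comp (φ := fun x => w ^ x)
            (ψ := fun x => w ^ x) Measurable.of_discrete Measurable.of_discrete) ?_ ?_
        · exact (integrable_comp_of_le (measurable_alternatingSum hm (by omega))
            (hb.mono fun ω h => alternatingSum_le_mul (by omega) h)
            fun x => w ^ x).aestronglyMeasurable
        · exact (integrable_comp_of_le (hm _ h2) hb2 fun x => w ^ x).aestronglyMeasurable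
    have hν : 0 ≤ factorialMoment 1 (X (k + 1)) μ := factorialMoment_nonneg 1 (X (k + 1))
    calc _ = (∫ ω, w ^ alternatingSum X k ω ∂μ) * ∫ ω, w ^ X (k + 2) ω ∂μ := hprod
      _ ≤ Real.exp (w ^ C * ∑ j ∈ Finset.Icc 1 k, factorialMoment 1 (X j) μ)
          * Real.exp (w ^ C * factorialMoment 1 (X (k + 2)) μ) := by
        refine mul_le_mul (ih (by omega)) (integral_pow_le_exp hw (hm _ h2) hb2)
          (integral_nonneg fun ω => by positivity) (Real.exp_nonneg _)
      _ ≤ _ := by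
        rw [← Real.exp_add, ← mul_add, Finset.sum_Icc_succ_top (b := k + 1) (by omega),
          Finset.sum_Icc_succ_top (b := k) (by omega)]
        refine Real.exp_le_exp.2 (mul_le_mul_of_nonneg_left ?_ (by positivity))
        linarith

lemma IsMDependent.integral_pow_sum_le (hd : IsMDependent 1 n X μ)
    (hm : ∀ i ∈ Finset.Icc 1 n, Measurable (X i))
    (hb : ∀ᵐ ω ∂μ, ∀ i ∈ Finset.Icc 1 n, X i ω ≤ C) {w : ℝ} (hw : 1 ≤ w) :
    ∫ ω, w ^ (∑ i ∈ Finset.Icc 1 n, X i ω) ∂μ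
      ≤ Real.exp ((w ^ 2) ^ C * ∑ j ∈ Finset.Icc 1 n, factorialMoment 1 (X j) μ) := by
  rcases n with _ | k
  · simp
  have hw2 : 1 ≤ w ^ 2 := one_le_pow₀ hw
  have hi : ∀ l ≤ k + 1, Integrable (fun ω => (w ^ 2) ^ alternatingSum X l ω) μ := fun l hl =>
    integrable_comp_of_le (measurable_alternatingSum hm hl)
      (hb.mono fun ω h => alternatingSum_le_mul hl h) fun x => (w ^ 2) ^ x
  have h1 := hd.integral_pow_alternatingSum_le hm hb hw2 (k := k + 1) le_rfl
  have h2 := hd.integral_pow_alternatingSum_le hm hb hw2 (k := k) (by omega)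
  have h3 : Real.exp ((w ^ 2) ^ C * ∑ j ∈ Finset.Icc 1 k, factorialMoment 1 (X j) μ)
      ≤ Real.exp ((w ^ 2) ^ C * ∑ j ∈ Finset.Icc 1 (k + 1), factorialMoment 1 (X j) μ) := by
    refine Real.exp_le_exp.2 (mul_le_mul_of_nonneg_left ?_ (by positivity))
    exact Finset.sum_le_sum_of_subset_of_nonneg (Finset.Icc_subset_Icc_right (by omega))
      fun _ _ _ => factorialMoment_nonneg 1 _
  calc _ ≤ ∫ ω, (1 / 2 * (w ^ 2) ^ alternatingSum X (k + 1) ω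
          + 1 / 2 * (w ^ 2) ^ alternatingSum X k ω) ∂μ := by
        refine integral_mono (integrable_comp_sum hm hb le_rfl fun x => w ^ x)
          (((hi _ le_rfl).const_mul _).add ((hi _ (by omega)).const_mul _)) fun ω => ?_
        simp only [← alternatingSum_succ_add, pow_add, pow_right_comm w 2]
        -- `x y ≤ (x² + y²) / 2`
        nlinarith [sq_nonneg (w ^ alternatingSum X (k + 1) ω - w ^ alternatingSum X k ω)]
    _ = 1 / 2 * ∫ ω, (w ^ 2) ^ alternatingSum X (k + 1) ω ∂μ
          + 1 / 2 * ∫ ω, (w ^ 2) ^ alternatingSum X k ω ∂μ := by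
        rw [integral_add ((hi _ le_rfl).const_mul _) ((hi _ (by omega)).const_mul _),
          integral_const_mul, integral_const_mul]
    _ ≤ _ := by linarith

end Row

/-! ### Convergence to the compound Poisson distribution -/

/-- The limits prescribed for the factorial moments are those of the jump measure of
`compoundPoisson s lam`. -/
lemma sum_sub_one_pow_mul_sum_choose (s : ℕ) (lam : ℕ → ℝ≥0) (z : ℂ) :
    ∑ m ∈ Finset.Icc 1 s, (z - 1) ^ m *
        ((∑ l ∈ Finset.Icc m s, (l.choose m : ℝ) * (lam l : ℝ) : ℝ) : ℂ)
      = ∑ l ∈ Finset.Icc 1 s, (lam l : ℂ) * (z ^ l - 1) := by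
  have h1 : ∀ l, z ^ l - 1 = ∑ m ∈ Finset.Icc 1 l, (z - 1) ^ m * (l.choose m : ℂ) := by
    intro l
    rw [pow_eq_sum_sub_one_pow_mul_choose z l, Finset.sum_range_succ_eq_add_sum_Icc]
    simp
  simp_rw [h1, Complex.ofReal_sum, Finset.mul_sum]
  rw [Finset.sum_comm' (t' := Finset.Icc 1 s) (s' := fun l => Finset.Icc 1 l)
    (by intro m l; simp only [Finset.mem_Icc]; omega)]
  refine Finset.sum_congr rfl fun l _ => Finset.sum_congr rfl fun m _ => ?_
  push_cast
  ring

theorem mainTheorem2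
    (Ω : ℕ → Type*) [∀ n, MeasurableSpace (Ω n)]
    (μ : ∀ n, Measure (Ω n)) [∀ n, IsProbabilityMeasure (μ n)]
    (X : ∀ n, ℕ → Ω n → ℕ)
    (hX_meas : ∀ n, ∀ i ∈ Finset.Icc 1 n, Measurable (X n i))
    (hX_dep : ∀ n, IsMDependent 1 n (X n) (μ n))
    (C₀ : ℝ) (hC₀ : 1 ≤ C₀)
    (hX_bdd : ∀ n, ∀ i ∈ Finset.Icc 1 n, ∀ᵐ ω ∂(μ n), (X n i ω : ℝ) ≤ C₀)
    (s : ℕ) (hs : 1 ≤ s) (lam : ℕ → ℝ≥0) (h : ℝ) (hh : 0 ≤ h)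
    (h_max : Tendsto
      (fun n => ⨆ j : Finset.Icc 1 n, factorialMoment 1 (X n j) (μ n)) atTop (𝓝 0))
    (h_moments : ∀ m ∈ Finset.Icc 1 s, Tendsto
      (fun n => 1 / (Nat.factorial m : ℝ) *
        ∑ j ∈ Finset.Icc 1 n, factorialMoment m (X n j) (μ n)) atTop
      (𝓝 (∑ l ∈ Finset.Icc m s, (Nat.choose l m : ℝ) * (lam l : ℝ))))
    (h_tail : Tendsto
      (fun n => ∑ j ∈ Finset.Icc 1 n, factorialMoment (s + 1) (X n j) (μ n)) atTop (𝓝 0))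
    (h_cov : Tendsto
      (fun n => ∑ j ∈ Finset.Icc 2 n,
        |covariance (fun ω => (X n (j - 1) ω : ℝ)) (fun ω => (X n j ω : ℝ)) (μ n)|)
      atTop (𝓝 0)) :
    (∀ n, Summable fun k : ℕ => Real.exp (h * k) *
      |((μ n).map fun ω => ∑ i ∈ Finset.Icc 1 n, X n i ω).real {k}
        - (compoundPoisson s lam).real {k}|) ∧
    Tendsto (fun n => ∑' k : ℕ, Real.exp (h * k) *
      |((μ n).map fun ω => ∑ i ∈ Finset.Icc 1 n, X n i ω).real {k}
        - (compoundPoisson s lam).real {k}|) atTop (𝓝 0) := by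
  set C : ℕ := ⌊C₀⌋₊
  have hb : ∀ n, ∀ᵐ ω ∂(μ n), ∀ i ∈ Finset.Icc 1 n, X n i ω ≤ C := fun n =>
    (Filter.eventually_all_finset _).2 fun i hi =>
      (hX_bdd n i hi).mono fun ω hω => Nat.le_floor hω
  set ρ : ℕ → Measure ℕ := fun n => (μ n).map fun ω => ∑ i ∈ Finset.Icc 1 n, X n i ω with hρ
  have hSm : ∀ n, Measurable fun ω => ∑ i ∈ Finset.Icc 1 n, X n i ω := fun n =>
    measurable_sum_Icc (hX_meas n) le_rfl
  have hρp : ∀ n, IsProbabilityMeasure (ρ n) := fun n =>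
    Measure.isProbabilityMeasure_map (hSm n).aemeasurable
  have hmean : Tendsto (fun n => ∑ j ∈ Finset.Icc 1 n, factorialMoment 1 (X n j) (μ n)) atTop
      (𝓝 (∑ l ∈ Finset.Icc 1 s, (Nat.choose l 1 : ℝ) * (lam l : ℝ))) := by
    simpa using h_moments 1 (Finset.mem_Icc.2 ⟨le_rfl, hs⟩)
  -- convergence of the generating functions on the unit circle
  have hgen : ∀ z : ℂ, ‖z‖ = 1 → Tendsto (fun n => ∫ x, z ^ x ∂(ρ n)) atTop
      (𝓝 (∫ x, z ^ x ∂(compoundPoisson s lam))) := by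
    intro z hz
    have hexp : Tendsto (fun n => ∑ j ∈ Finset.Icc 1 n, (∫ ω, z ^ X n j ω ∂(μ n) - 1)) atTop
        (𝓝 (∑ l ∈ Finset.Icc 1 s, (lam l : ℂ) * (z ^ l - 1))) := by
      have hlim : Tendsto (fun n => ∑ m ∈ Finset.Icc 1 s, (z - 1) ^ m *
          ((1 / (m.factorial : ℝ) *
            ∑ j ∈ Finset.Icc 1 n, factorialMoment m (X n j) (μ n) : ℝ) : ℂ)) atTop
          (𝓝 (∑ l ∈ Finset.Icc 1 s, (lam l : ℂ) * (z ^ l - 1))) := by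
        rw [← sum_sub_one_pow_mul_sum_choose]
        exact tendsto_finsetSum _ fun m hm =>
          ((Complex.continuous_ofReal.tendsto _).comp (h_moments m hm)).const_mul _
      have hdiff := squeeze_zero_norm (fun n =>
        norm_sum_integral_pow_sub_sum_factorialMoment_le (hX_meas n) (hb n) hz s)
        (by simpa using h_tail.const_mul (2 * 3 ^ C : ℝ))
      simpa using hdiff.add hlim
    have hdiff := squeeze_zero_norm (fun n =>
      (hX_dep n).norm_integral_pow_sum_sub_exp_le (hX_meas n) (hb n) hz
        (fun i hi => le_ciSup (f := fun j : Finset.Icc 1 n => factorialMoment 1 (X n j) (μ n))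
          (Set.finite_range _).bddAbove ⟨i, hi⟩) le_rfl)
      (by simpa using (h_cov.const_mul 4).add ((h_max.const_mul 16).mul hmean))
    have := hdiff.add ((Complex.continuous_exp.tendsto _).comp hexp)
    rw [integral_pow_compoundPoisson]
    simp only [Function.comp_def, sub_add_cancel, zero_add] at this
    refine this.congr fun n => ?_
    rw [hρ, integral_map (hSm n).aemeasurable StronglyMeasurable.of_discrete.aestronglyMeasurable]
  have hpt := tendsto_real_singleton_of_tendsto_integral_pow hgen
  -- uniform exponential moments, one order above `h`
  set R : ℝ := Real.exp (h + 1) with hR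
  have hR1 : 1 ≤ R := Real.one_le_exp (by linarith)
  obtain ⟨B, hB⟩ := hmean.bddAbove_range
  set M₁ : ℝ := Real.exp ((R ^ 2) ^ C * B)
  have hM₁ : ∀ n k, R ^ k * (ρ n).real {k} ≤ M₁ := by
    intro n k
    have hi : Integrable (fun x : ℕ => R ^ x) (ρ n) := by
      rw [hρ, integrable_map_measure StronglyMeasurable.of_discrete.aestronglyMeasurable
        (hSm n).aemeasurable]
      exact integrable_comp_sum (hX_meas n) (hb n) le_rfl fun x => R ^ x
    refine (pow_mul_real_singleton_le_integral (by linarith) hi k).trans ?_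
    rw [hρ, integral_map (hSm n).aemeasurable StronglyMeasurable.of_discrete.aestronglyMeasurable]
    refine ((hX_dep n).integral_pow_sum_le (hX_meas n) (hb n) hR1).trans ?_
    exact Real.exp_le_exp.2 (mul_le_mul_of_nonneg_left (hB ⟨n, rfl⟩) (by positivity))
  set M₂ : ℝ := ∫ x, R ^ x ∂(compoundPoisson s lam)
  have hM₂ : ∀ k, R ^ k * (compoundPoisson s lam).real {k} ≤ M₂ := by
    refine pow_mul_real_singleton_le_integral (by linarith) ?_
    refine (integrable_pow_compoundPoisson s lam (R : ℂ)).norm.congr ?_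
    refine Filter.Eventually.of_forall fun x => ?_
    simp [abs_of_nonneg (zero_le_one.trans hR1)]
  have hbound : ∀ (n k : ℕ), Real.exp (h * k) * |(ρ n).real {k} - (compoundPoisson s lam).real {k}|
      ≤ Real.exp (-k) * (M₁ + M₂) := by
    intro n k
    have h1 : Real.exp (h * k) = Real.exp (-k) * R ^ k := by
      rw [hR, ← Real.exp_nat_mul, ← Real.exp_add]
      ring_nf
    rw [h1, mul_assoc]
    have h2 : |(ρ n).real {k} - (compoundPoisson s lam).real {k}|
        ≤ (ρ n).real {k} + (compoundPoisson s lam).real {k} := by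
      refine (abs_sub _ _).trans ?_
      rw [abs_of_nonneg measureReal_nonneg, abs_of_nonneg measureReal_nonneg]
    gcongr
    calc _ ≤ R ^ k * ((ρ n).real {k} + (compoundPoisson s lam).real {k}) := by gcongr
      _ ≤ M₁ + M₂ := by rw [mul_add]; exact add_le_add (hM₁ n k) (hM₂ k)
  have hsum : Summable fun k : ℕ => Real.exp (-k) * (M₁ + M₂) :=
    Real.summable_exp_neg_nat.mul_right _
  refine ⟨fun n => Summable.of_nonneg_of_le (fun k => by positivity) (hbound n) hsum, ?_⟩
  have := tendsto_tsum_of_dominated_convergence (𝓕 := atTop)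
    (f := fun n (k : ℕ) => Real.exp (h * k) * |(ρ n).real {k} - (compoundPoisson s lam).real {k}|)
    (g := fun _ => (0 : ℝ)) hsum
    (fun k => by
      simpa using (((hpt k).sub_const ((compoundPoisson s lam).real {k})).abs).const_mul
        (Real.exp (h * k)))
    (Filter.Eventually.of_forall fun n k => by
      rw [Real.norm_of_nonneg (by positivity)]
      exact hbound n k)
  simpa using this
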